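/- Call a function $f\colon\mathbb{R}^n\to\mathbb{R}$ additive if $f(x)+f(y)=f(x+y)$ for all $x,y\in\mathbb{R}^n$. For $\varepsilon>0$ and a probability distribution $\mathcal{D}$ on $\mathbb{R}^n$, a measurable $f$ is $\varepsilon$-far from additive with respect to $\mathcal{D}$ if $\Pr_{x\sim\mathcal{D}}[f(x)\neq g(x)]>\varepsilon$ for every measurable additive $g\colon\mathbb{R}^n\to\mathbb{R}$. A sample-based algorithm using $q=q_1+q_2$ samples is a randomized algorithm that sees the unknown measurable function $f$ only through the pairs $(x,f(x))$ for $q_1$ points $x$ drawn from $\mathcal{D}$ and $q_2$ points $x$ drawn from the standard Gaussian $\mathcal{N}(0,I)$, all independent; it then accepts or rejects. It is a tester for additivity with distance parameter $\varepsilon$ over $\mathcal{D}$ if it accepts with probability at least $2/3$ whenever $f$ is measurable and additive, and rejects with probability at least $2/3$ whenever $f$ is measurable and $\varepsilon$-far from additive with respect to $\mathcal{D}$. **Corollary.** Any sample-based tester for additivity of functions $f\colon\mathbb{R}^n\to\mathbb{R}$ requires $\Omega(n)$ samples, even when $\mathcal{D}=\mathcal{N}(0,I)$. That is, there is an absolute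 constant $c>0$ such that for every $n$ and every $0<\varepsilon<1$, every sample-based tester for additivity with distance parameter $\varepsilon$ over $\mathcal{D}=\mathcal{N}(0,I)$ uses at least $c\,n$ samples. -/

import Mathlib

open MeasureTheory ProbabilityTheory
open scoped ENNReal

namespace AdditivityTesting

/-- The domain `ℝⁿ`, with its Euclidean structure. -/
abbrev Rn (n : ℕ) : Type := EuclideanSpace ℝ (Fin n)

/-- `f : ℝⁿ → ℝ` is additive (no homogeneity over `ℝ` is required). -/
def IsAdditive {n : ℕ} (f : Rn n → ℝ) : Prop :=
  ∀ x y : Rn n, f x + f y = f (x + y)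

/-- `f` is `ε`-far from the property `P` with respect to `D`: every measurable `g` with property `P`
satisfies `Pr_{x ∼ D}[f x ≠ g x] > ε`. -/
def IsFar {n : ℕ} (D : Measure (Rn n)) (ε : ℝ) (P : (Rn n → ℝ) → Prop) (f : Rn n → ℝ) : Prop :=
  ∀ g : Rn n → ℝ, Measurable g → P g → ENNReal.ofReal ε < D {x | f x ≠ g x}

/-- A labelled sample: a point `x` together with the value of the input function at `x`. -/
abbrev LabelledSample (n : ℕ) : Type := Rn n × ℝ

/-- What a sample-based algorithm sees: `q₁` labelled samples drawn from the distribution `D` and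
`q₂` labelled samples drawn from the standard Gaussian. -/
abbrev Observation (n q₁ q₂ : ℕ) : Type :=
  (Fin q₁ → LabelledSample n) × (Fin q₂ → LabelledSample n)

/-- The observation produced by the input function `f` on given sample points. -/
def observe {n q₁ q₂ : ℕ} (f : Rn n → ℝ) (s : (Fin q₁ → Rn n) × (Fin q₂ → Rn n)) :
    Observation n q₁ q₂ :=
  (fun i => (s.1 i, f (s.1 i)), fun j => (s.2 j, f (s.2 j)))

/-- The law of the observation when all `q₁ + q₂` sample points are independent, the first `q₁`
distributed as `D` and the other `q₂` as the standard Gaussian. -/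
noncomputable def observationLaw {n : ℕ} (q₁ q₂ : ℕ) (D : Measure (Rn n)) (f : Rn n → ℝ) :
    Measure (Observation n q₁ q₂) :=
  ((Measure.pi fun _ : Fin q₁ => D).prod
    (Measure.pi fun _ : Fin q₂ => stdGaussian (Rn n))).map (observe f)

/-- A randomized sample-based algorithm is a Markov kernel `A` from observations to verdicts: on the
observation `o`, it outputs `true` (accept) with probability `A o {true}` and `false` (reject) with
probability `A o {false}`, over its internal randomness. It has no other access to `f`.
This is the law of its verdict, over the samples and the internal randomness. -/
noncomputable def verdictLaw {n q₁ q₂ : ℕ} (A : Kernel (Observation n q₁ q₂) Bool)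
    (D : Measure (Rn n)) (f : Rn n → ℝ) : Measure Bool :=
  (observationLaw q₁ q₂ D f).bind A

/-- The sample-based algorithm `A` is a tester for the property `P` with distance parameter `ε`, when
the underlying distribution is `D`. -/
structure IsSampleBasedTester {n q₁ q₂ : ℕ} (A : Kernel (Observation n q₁ q₂) Bool)
    (D : Measure (Rn n)) (ε : ℝ) (P : (Rn n → ℝ) → Prop) : Prop where
  accepts : ∀ f : Rn n → ℝ, Measurable f → P f → 2 / 3 ≤ verdictLaw A D f {true}
  rejects : ∀ f : Rn n → ℝ, Measurable f → IsFar D ε P f → 2 / 3 ≤ verdictLaw A D f {false}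

end AdditivityTesting

/-!
A sample-based tester for additivity over the standard Gaussian on `ℝⁿ` needs more than `n` samples,
so the constant in the lower bound can be taken to be `1`.

A tester has to accept each linear function `⟪w, ·⟫` and to reject each `⟪w, ·⟫ + 1`, which differs
almost everywhere from every measurable additive function (`isFar_inner_add_one`). Suppose that it
uses at most `n` samples. These are almost surely linearly independent
(`ae_linearIndependent_prod_pi`), hence some vector `v`, depending on the sample points, satisfies
`⟪v, x⟫ = 1` at every sample point `x`. On such samples `⟪w, ·⟫ + 1` and `⟪w + v, ·⟫` produce the same
observation (`observe_affine_eq`).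

Let `w` be uniform on a ball of radius `R` centred at the origin. For fixed `v`, the laws of `w` and
`w + v` become indistinguishable as `R → ∞` (`lintegral_uniformBall_le`,
`tendsto_uniformBall_compl_ball`). Thus, for almost all fixed samples, the probability of accepting
`⟪w, ·⟫` plus the probability of rejecting `⟪w, ·⟫ + 1` is at most `1` in the limit. By the reverse
Fatou lemma the same holds after averaging over the samples, whereas for a tester this sum is at
least `2 / 3 + 2 / 3 = 4 / 3` for every `R`.
-/

namespace AdditivityTesting
open Filter Topology Metric

variable {E : Type*} [NormedAddCommGroup E] [InnerProductSpace ℝ E] [FiniteDimensional ℝ E]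

/-! ### Gaussian samples are linearly independent -/

/-- On linearly independent points, the constant label `1` is also the labelling produced by a
linear functional. -/
lemma exists_inner_eq_one {ι : Type*} {x : ι → E} (hx : LinearIndependent ℝ x) :
    ∃ v : E, ∀ i, inner ℝ v (x i) = 1 := by
  obtain ⟨g, hg⟩ := ((Module.Basis.span hx).constr ℝ fun _ => (1 : ℝ)).exists_extend
  refine ⟨(InnerProductSpace.toDual ℝ E).symm (LinearMap.toContinuousLinearMap g), fun i => ?_⟩
  have h := LinearMap.congr_fun hg (Module.Basis.span hx i)
  rw [Module.Basis.constr_basis] at h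
  simpa [Module.Basis.span_apply] using h

variable [MeasurableSpace E] [BorelSpace E]

lemma stdGaussian_setOf_dual_eq (L : StrongDual ℝ E) (hL : L ≠ 0) (c : ℝ) :
    stdGaussian E {x | L x = c} = 0 := by
  have hmap := IsGaussian.map_eq_gaussianReal (μ := stdGaussian E) L
  rw [variance_dual_stdGaussian] at hmap
  have hv : (‖L‖ ^ 2).toNNReal ≠ 0 := by
    simpa [Real.toNNReal_eq_zero] using hL
  have := nullSingletonClass_gaussianReal (μ := (stdGaussian E)[L]) hv
  have h0 : (stdGaussian E).map L {c} = 0 := by rw [hmap]; exact measure_singleton c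
  rwa [Measure.map_apply (by fun_prop) (measurableSet_singleton c)] at h0

lemma stdGaussian_submodule_eq_zero (W : Submodule ℝ E) (hW : W ≠ ⊤) :
    stdGaussian E (W : Set E) = 0 := by
  obtain ⟨f, hf, hle⟩ := W.exists_le_ker_of_lt_top hW.lt_top
  refine measure_mono_null (fun x hx => ?_)
    (stdGaussian_setOf_dual_eq (LinearMap.toContinuousLinearMap f) (by simpa using hf) 0)
  exact hle hx

lemma ae_linearIndependent_pi (q : ℕ) (hq : q ≤ Module.finrank ℝ E) :
    ∀ᵐ s ∂(Measure.pi fun _ : Fin q => stdGaussian E), LinearIndependent ℝ s := by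
  induction q with
  | zero => exact ae_of_all _ fun s => linearIndependent_empty_type
  | succ q ih =>
    have hmp := measurePreserving_piFinSuccAbove (fun _ : Fin (q + 1) => stdGaussian E) 0
    have hopen : IsOpen {s : Fin (q + 1) → E | LinearIndependent ℝ s} :=
      isOpen_setOfPred_linearIndependent
    have hmeas := (MeasurableEquiv.piFinSuccAbove (fun _ : Fin (q + 1) => E) 0).symm.measurable
      hopen.measurableSet
    rw [Set.preimage_ofPred_eq] at hmeas
    -- The factors are swapped so that the outer point `t` collects the last `q` points and the
    -- inner one is the first point, which has to avoid the span of `t`.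
    rw [← hmp.symm.map_eq, ae_map_iff (MeasurableEquiv.measurable _).aemeasurable
      hopen.measurableSet, ← Measure.prod_swap, ae_map_iff measurable_swap.aemeasurable hmeas]
    refine (Measure.ae_prod_iff_ae_ae (measurable_swap hmeas)).2 ?_
    filter_upwards [ih (by omega)] with t ht
    have hspan : Submodule.span ℝ (Set.range t) ≠ ⊤ := fun h => by
      have := finrank_span_eq_card ht
      rw [h, finrank_top, Fintype.card_fin] at this
      omega
    filter_upwards [measure_eq_zero_iff_ae_notMem.1 (stdGaussian_submodule_eq_zero _ hspan)]
      with x hx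
    simp only [Prod.swap_prod_mk, MeasurableEquiv.piFinSuccAbove_symm_apply,
      Fin.insertNthEquiv_zero]
    exact linearIndependent_finCons.2 ⟨ht, hx⟩

lemma ae_linearIndependent_prod_pi (q₁ q₂ : ℕ) (hq : q₁ + q₂ ≤ Module.finrank ℝ E) :
    ∀ᵐ s ∂((Measure.pi fun _ : Fin q₁ => stdGaussian E).prod
      (Measure.pi fun _ : Fin q₂ => stdGaussian E)), LinearIndependent ℝ (Sum.elim s.1 s.2) := by
  have h := ae_linearIndependent_pi (E := E) (q₁ + q₂) hq
  rw [← (measurePreserving_piCongrLeft (fun _ : Fin (q₁ + q₂) => stdGaussian E)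
      finSumFinEquiv).map_eq,
    ← (measurePreserving_sumPiEquivProdPi_symm (X := fun _ : Fin q₁ ⊕ Fin q₂ => E)
      (fun _ => stdGaussian E)).map_eq] at h
  filter_upwards [ae_of_ae_map (MeasurableEquiv.measurable _).aemeasurable
    (ae_of_ae_map (MeasurableEquiv.measurable _).aemeasurable h)] with s hs
  have := (linearIndependent_equiv finSumFinEquiv).2 hs
  convert this using 1
  ext i
  simp only [Function.comp_apply, MeasurableEquiv.coe_piCongrLeft,
    Equiv.piCongrLeft_apply_apply]
  cases i <;> rfl

/-! ### Almost translation-invariant random vectors -/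

/-- The uniform probability measure on the open ball of radius `k + 1` centred at the origin; the
radius is positive for every `k : ℕ`. -/
noncomputable def uniformBall (E : Type*) [NormedAddCommGroup E] [InnerProductSpace ℝ E]
    [FiniteDimensional ℝ E] [MeasurableSpace E] [BorelSpace E] (k : ℕ) : Measure E :=
  cond volume (ball (0 : E) (k + 1))

instance (k : ℕ) : IsProbabilityMeasure (uniformBall E k) :=
  cond_isProbabilityMeasure_of_finite (measure_ball_pos volume (0 : E) (by positivity)).ne'
    measure_ball_lt_top.ne

/-- Translating the argument of a function with values in `[0, 1]` lowers its average over a ball by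
at most the proportion of the ball outside its translate. No measurability of `F` is needed,
because the domain is split along a measurable set. -/
lemma lintegral_uniformBall_le (k : ℕ) (v : E) {F : E → ℝ≥0∞} (hF : ∀ w, F w ≤ 1) :
    ∫⁻ w, F w ∂uniformBall E k ≤
      ∫⁻ w, F (w + v) ∂uniformBall E k + uniformBall E k (ball v (k + 1))ᶜ := by
  set B := ball (0 : E) (k + 1)
  set B' := ball v (k + 1)
  have hshift : ∫⁻ w in B, F (w + v) = ∫⁻ w in B', F w := by
    have h := (measurePreserving_add_right (volume : Measure E) v).setLIntegral_comp_preimage_emb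
      (MeasurableEquiv.addRight v).measurableEmbedding F B'
    have hB : (fun w => w + v) ⁻¹' B' = B := by
      ext w; simp [B, B']
    rwa [hB] at h
  have hsplit : ∫⁻ w in B, F w ≤ (∫⁻ w in B', F w) + volume (B ∩ B'ᶜ) := by
    rw [← lintegral_inter_add_sdiff F B (measurableSet_ball : MeasurableSet B')]
    refine add_le_add (lintegral_mono_set Set.inter_subset_right) ?_
    exact (lintegral_mono hF).trans (by simp [Set.sdiff_eq, B'])
  rw [uniformBall, cond_apply measurableSet_ball, ProbabilityTheory.cond, lintegral_smul_measure,
    lintegral_smul_measure, hshift, smul_eq_mul, smul_eq_mul, ← mul_add]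
  exact mul_le_mul_right hsplit _

lemma tendsto_uniformBall_compl_ball (v : E) :
    Tendsto (fun k : ℕ => uniformBall E k (ball v (k + 1))ᶜ) atTop (𝓝 0) := by
  have hlim : Tendsto (fun k : ℕ => 1 - ENNReal.ofReal
      ((1 - ‖v‖ / ((k : ℝ) + 1)) ^ Module.finrank ℝ E)) atTop (𝓝 0) := by
    have h1 : Tendsto (fun k : ℕ => (1 - ‖v‖ / ((k : ℝ) + 1)) ^ Module.finrank ℝ E) atTop
        (𝓝 ((1 - 0) ^ Module.finrank ℝ E)) :=
      (tendsto_const_nhds.sub (tendsto_const_nhds.div_atTop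
        (tendsto_natCast_atTop_atTop.atTop_add tendsto_const_nhds))).pow _
    have h2 := ENNReal.Tendsto.sub (tendsto_const_nhds (x := (1 : ℝ≥0∞)))
      (ENNReal.tendsto_ofReal h1) (Or.inl ENNReal.one_ne_top)
    simpa using h2
  refine tendsto_of_tendsto_of_tendsto_of_le_of_le' tendsto_const_nhds hlim
    (Eventually.of_forall fun _ => zero_le) ?_
  filter_upwards [tendsto_natCast_atTop_atTop.eventually_ge_atTop ‖v‖] with k hk
  have hR : (0 : ℝ) < k + 1 := by positivity
  have hr : 0 < 1 - ‖v‖ / ((k : ℝ) + 1) := by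
    rw [sub_pos, div_lt_one hR]; linarith
  rw [prob_compl_eq_one_sub measurableSet_ball]
  gcongr
  set r := 1 - ‖v‖ / ((k : ℝ) + 1)
  -- The ball of radius `(k + 1) - ‖v‖` lies in both balls, and its share of the volume is
  -- `r ^ finrank`.
  have hsub : ball (0 : E) (((k : ℝ) + 1) * r) ⊆ ball (0 : E) (k + 1) ∩ ball v (k + 1) := by
    have hmul : ((k : ℝ) + 1) * r = k + 1 - ‖v‖ := by simp only [r]; field_simp
    rw [hmul]
    refine Set.subset_inter (ball_subset_ball (by linarith [norm_nonneg v])) (ball_subset ?_)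
    simp
  calc ENNReal.ofReal (r ^ Module.finrank ℝ E)
      = (volume (ball (0 : E) (k + 1)))⁻¹ * volume (ball (0 : E) (((k : ℝ) + 1) * r)) := by
        rw [mul_comm ((k : ℝ) + 1) r, Measure.addHaar_ball_mul_of_pos _ _ hr, mul_left_comm,
          ENNReal.inv_mul_cancel (measure_ball_pos volume (0 : E) hR).ne' measure_ball_lt_top.ne,
          mul_one]
    _ ≤ uniformBall E k (ball v (k + 1)) := by
        rw [uniformBall, cond_apply measurableSet_ball]
        gcongr

/-! ### Affine functions with constant term one are far from additive -/

/-- A measurable solution of Cauchy's functional equation is continuous and linear. -/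
lemma IsAdditive.exists_strongDual {n : ℕ} {g : Rn n → ℝ} (hg : IsAdditive g) (hm : Measurable g) :
    ∃ L : StrongDual ℝ (Rn n), ⇑L = g := by
  let G : Rn n →+ ℝ := AddMonoidHom.mk' g fun x y => (hg x y).symm
  exact ⟨G.toRealLinearMap (MeasureTheory.Measure.AddMonoidHom.continuous_of_measurable G hm), rfl⟩

/-- The function `⟪w, ·⟫ + 1` and an additive function agree on an affine hyperplane, which is
null, or nowhere when their linear parts coincide. -/
lemma isFar_inner_add_one {n : ℕ} {ε : ℝ} (hε : ε < 1) (w : Rn n) :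
    IsFar (stdGaussian (Rn n)) ε IsAdditive fun x => inner ℝ w x + 1 := by
  intro g hm hg
  obtain ⟨L, rfl⟩ := hg.exists_strongDual hm
  have h0 : stdGaussian (Rn n) {x | (L - innerSL ℝ w) x = 1} = 0 := by
    by_cases hL : L - innerSL ℝ w = 0
    · simp [hL]
    · exact stdGaussian_setOf_dual_eq _ hL 1
  have h1 : stdGaussian (Rn n) {x | inner ℝ w x + 1 ≠ L x} = 1 := by
    rw [← prob_compl_eq_zero_iff (by measurability)]
    convert h0 using 2
    ext x
    simp only [Set.mem_compl_iff, Set.mem_ofPred_eq, not_not, sub_apply,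
      innerSL_apply_apply]
    exact ⟨fun h => by linarith, fun h => by linarith⟩
  rw [h1]
  exact ENNReal.ofReal_lt_one.2 hε

/-! ### The verdict on random affine functions -/

lemma verdictLaw_apply {n q₁ q₂ : ℕ} (A : Kernel (Observation n q₁ q₂) Bool)
    (D : Measure (Rn n)) {f : Rn n → ℝ} (hf : Measurable f) (b : Bool) :
    verdictLaw A D f {b} = ∫⁻ s, A (observe f s) {b} ∂((Measure.pi fun _ : Fin q₁ => D).prod
      (Measure.pi fun _ : Fin q₂ => stdGaussian (Rn n))) := by
  have hobs : Measurable (observe f : _ → Observation n q₁ q₂) := by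
    unfold observe; fun_prop
  rw [verdictLaw, Measure.bind_apply (measurableSet_singleton b) A.aemeasurable, observationLaw,
    lintegral_map (A.measurable_coe (measurableSet_singleton b)) hobs]

lemma measurable_observe_affine (n q₁ q₂ : ℕ) (c : ℝ) :
    Measurable fun p : Rn n × ((Fin q₁ → Rn n) × (Fin q₂ → Rn n)) =>
      observe (fun x => inner ℝ p.1 x + c) p.2 := by
  unfold observe
  fun_prop

/-- A lower bound on the probability of a verdict for every `⟪w, ·⟫ + c` remains valid when `w` is
random, independent of the samples, and the average over `w` can be taken for fixed samples. -/
lemma le_lintegral_affine {n q₁ q₂ : ℕ} (A : Kernel (Observation n q₁ q₂) Bool)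
    (D : Measure (Rn n)) [IsProbabilityMeasure D] (ν : Measure (Rn n)) [IsProbabilityMeasure ν]
    (b : Bool) (c : ℝ) (a : ℝ≥0∞) (h : ∀ w, a ≤ verdictLaw A D (fun x => inner ℝ w x + c) {b}) :
    a ≤ ∫⁻ s, ∫⁻ w, A (observe (fun x => inner ℝ w x + c) s) {b} ∂ν
      ∂((Measure.pi fun _ : Fin q₁ => D).prod
        (Measure.pi fun _ : Fin q₂ => stdGaussian (Rn n))) := by
  rw [← lintegral_lintegral_swap
    (f := fun w s => A (observe (fun x => inner ℝ w x + c) s) {b})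
    ((A.measurable_coe (measurableSet_singleton b)).comp
      (measurable_observe_affine n q₁ q₂ c)).aemeasurable]
  calc a = ∫⁻ _, a ∂ν := by simp
    _ ≤ _ := lintegral_mono fun w => by
      rw [← verdictLaw_apply A D (by fun_prop) b]
      exact h w

/-- The observation cannot tell the function `⟪w, ·⟫ + 1` from `⟪w + v, ·⟫` when `⟪v, ·⟫` is `1` at
every sample point. The summand `0` puts both functions in the form `⟪w, ·⟫ + c`. -/
lemma observe_affine_eq {n q₁ q₂ : ℕ} {s : (Fin q₁ → Rn n) × (Fin q₂ → Rn n)} {v : Rn n}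
    (hv : ∀ i, inner ℝ v (Sum.elim s.1 s.2 i) = 1) (w : Rn n) :
    observe (fun x => inner ℝ (w + v) x + 0) s = observe (fun x => inner ℝ w x + 1) s := by
  have h₁ i : inner ℝ v (s.1 i) = 1 := hv (.inl i)
  have h₂ i : inner ℝ v (s.2 i) = 1 := hv (.inr i)
  simp [observe, inner_add_left, h₁, h₂]

/-! ### The lower bound -/

/-- A tester for additivity over the standard Gaussian uses more than `n` samples. -/
theorem lt_card_samples_of_tester {n q₁ q₂ : ℕ} {ε : ℝ} (hε : ε < 1)
    (A : Kernel (Observation n q₁ q₂) Bool) [IsMarkovKernel A]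
    (hA : IsSampleBasedTester A (stdGaussian (Rn n)) ε IsAdditive) : n < q₁ + q₂ := by
  by_contra! hq
  set P := (Measure.pi fun _ : Fin q₁ => stdGaussian (Rn n)).prod
    (Measure.pi fun _ : Fin q₂ => stdGaussian (Rn n))
  let T (s : (Fin q₁ → Rn n) × (Fin q₂ → Rn n)) (w : Rn n) : ℝ≥0∞ :=
    A (observe (fun x => inner ℝ w x + 0) s) {true}
  let U (s : (Fin q₁ → Rn n) × (Fin q₂ → Rn n)) (w : Rn n) : ℝ≥0∞ :=
    A (observe (fun x => inner ℝ w x + 1) s) {false}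
  -- For fixed samples `s`: the probability of accepting a random linear function plus that of
  -- rejecting a random linear function shifted by the constant `1`.
  let Φ (k : ℕ) (s : (Fin q₁ → Rn n) × (Fin q₂ → Rn n)) : ℝ≥0∞ :=
    ∫⁻ w, T s w ∂uniformBall (Rn n) k + ∫⁻ w, U s w ∂uniformBall (Rn n) k
  have hmeas (b : Bool) (c : ℝ) (k : ℕ) : Measurable fun s => ∫⁻ w,
      A (observe (q₁ := q₁) (q₂ := q₂) (fun x => inner ℝ w x + c) s) {b}
        ∂uniformBall (Rn n) k :=
    ((A.measurable_coe (measurableSet_singleton b)).comp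
      (measurable_observe_affine n q₁ q₂ c)).lintegral_prod_left'
  have hlower (k : ℕ) : 4 / 3 ≤ ∫⁻ s, Φ k s ∂P := by
    have hT := le_lintegral_affine A (stdGaussian (Rn n)) (uniformBall (Rn n) k) true 0 (2 / 3)
      fun w => hA.accepts _ (by fun_prop) fun x y => by simp [inner_add_right]
    have hU := le_lintegral_affine A (stdGaussian (Rn n)) (uniformBall (Rn n) k) false 1 (2 / 3)
      fun w => hA.rejects _ (by fun_prop) (isFar_inner_add_one hε w)
    calc (4 / 3 : ℝ≥0∞) = 2 / 3 + 2 / 3 := by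
          rw [← ENNReal.add_div]; norm_num
      _ ≤ _ := add_le_add hT hU
      _ = ∫⁻ s, Φ k s ∂P := (lintegral_add_left (hmeas true 0 k) _).symm
  have hupper (k : ℕ) (s) : Φ k s ≤ 2 := by
    have h (F : Rn n → ℝ≥0∞) (hF : ∀ w, F w ≤ 1) : ∫⁻ w, F w ∂uniformBall (Rn n) k ≤ 1 :=
      (lintegral_mono hF).trans (by simp)
    calc Φ k s ≤ 1 + 1 := add_le_add (h _ fun _ => prob_le_one) (h _ fun _ => prob_le_one)
      _ = 2 := one_add_one_eq_two
  have hlimsup : ∀ᵐ s ∂P, limsup (fun k => Φ k s) atTop ≤ 1 := by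
    filter_upwards [ae_linearIndependent_prod_pi (E := Rn n) q₁ q₂ (by simpa using hq)] with s hs
    obtain ⟨v, hv⟩ := exists_inner_eq_one hs
    -- Both cases produce almost the same distribution of labels on `s`, so the probabilities of
    -- the two correct answers add up to at most `1`, up to an error that vanishes in `k`.
    have hle (k : ℕ) : Φ k s ≤ 1 + uniformBall (Rn n) k (ball v (k + 1))ᶜ := by
      have hTU (w : Rn n) : T s (w + v) + U s w = 1 := by
        simp only [T, U]
        rw [observe_affine_eq hv, ← measure_union (by simp) (measurableSet_singleton _)]
        convert measure_univ (μ := A (observe (fun x => inner ℝ w x + 1) s)) using 2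
        ext b; cases b <;> simp
      have hmU : Measurable (U s) :=
        (A.measurable_coe (measurableSet_singleton false)).comp
          ((measurable_observe_affine n q₁ q₂ 1).comp measurable_prodMk_right)
      calc Φ k s ≤ (∫⁻ w, T s (w + v) ∂uniformBall (Rn n) k
              + uniformBall (Rn n) k (ball v (k + 1))ᶜ) + ∫⁻ w, U s w ∂uniformBall (Rn n) k :=
            add_le_add_left (lintegral_uniformBall_le k v fun _ => prob_le_one) _
        _ = ∫⁻ w, (T s (w + v) + U s w) ∂uniformBall (Rn n) k
              + uniformBall (Rn n) k (ball v (k + 1))ᶜ := by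
            rw [lintegral_add_right _ hmU, add_right_comm]
        _ = _ := by simp [hTU]
    have hlim : Tendsto (fun k : ℕ => 1 + uniformBall (Rn n) k (ball v (k + 1))ᶜ) atTop (𝓝 1) := by
      simpa using (tendsto_uniformBall_compl_ball v).const_add 1
    exact (limsup_le_limsup (Eventually.of_forall hle)).trans hlim.limsup_eq.le
  have h43 : (4 / 3 : ℝ≥0∞) ≤ 1 :=
    calc (4 / 3 : ℝ≥0∞) ≤ limsup (fun k => ∫⁻ s, Φ k s ∂P) atTop :=
          le_limsup_of_frequently_le (Frequently.of_forall hlower)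
      _ ≤ ∫⁻ s, limsup (fun k => Φ k s) atTop ∂P :=
          limsup_lintegral_le (fun _ => 2) (fun k => (hmeas true 0 k).add (hmeas false 1 k))
            (fun k => ae_of_all _ (hupper k)) (by simp)
      _ ≤ ∫⁻ _, 1 ∂P := lintegral_mono_ae hlimsup
      _ = 1 := by simp
  rw [ENNReal.div_le_iff (by norm_num) (by norm_num)] at h43
  norm_num at h43

end AdditivityTesting

theorem mainTheorem6 :
    ∃ c : ℝ, 0 < c ∧
      ∀ (n q₁ q₂ : ℕ) (ε : ℝ), 0 < ε → ε < 1 →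
        ∀ (A : Kernel (AdditivityTesting.Observation n q₁ q₂) Bool), IsMarkovKernel A →
          AdditivityTesting.IsSampleBasedTester A (stdGaussian (AdditivityTesting.Rn n)) ε
            AdditivityTesting.IsAdditive →
          c * (n : ℝ) ≤ (q₁ : ℝ) + (q₂ : ℝ) := by
  refine ⟨1, one_pos, fun n q₁ q₂ ε _ hε A _ hA => ?_⟩
  rw [one_mul]
  exact_mod_cast (AdditivityTesting.lt_card_samples_of_tester hε A hA).le
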